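/- Let $\pi$ be a permutation of $\{1,2,3,4\}$ in the Rauzy class of $(4321)$ (seven permutations), where $\pi(j)$ is the position of the $j$-th interval after the exchange. Put $$\sigma(0)=\pi^{-1}(1)-1,\qquad \sigma(\pi^{-1}(4))=4,\qquad \sigma(j)=\pi^{-1}(\pi(j)+1)-1\ \text{ otherwise}\quad(1\le j\le 4).$$ Let $\lambda=(\lambda_1,\dots,\lambda_4)$ with $\lambda_i>0$, $h=(h_1,\dots,h_4)$ and $a=(a_0,\dots,a_4)$ be real vectors with $a_0=a_4=0$, $a_1,a_2,a_3>0$, and put $h_0=h_5=0$. Suppose that they are zippered rectangle data of area one with transversal of length at most one: * $h_i-a_i=h_{\sigma(i)+1}-a_{\sigma(i)}$ for $0\le i\le 4$; * $h_i,a_i\ge 0$ for $1\le i\le 4$, $\ h_4\ge a_4\ge -h_{\pi^{-1}(4)}$, $\ h_{\pi^{-1}(4)+1}\ge a_{\pi^{-1}(4)}$, and $\min(h_i,h_{i+1})\ge a_i$ for $0<i<4$, $i\ne\pi^{-1}(4)$; * $\sum_i\lambda_ih_i=1$ and $\sum_i\lambda_i\le 1$. Let $S$ be the translation surface (with one cone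 point, of angle $6\pi$) obtained from the rectangles $R_i=[0,\lambda_i]\times[0,h_i]$, placed side by side on a horizontal segment $X$ of length $\sum_i\lambda_i$ (the transversal), by the following identifications by translation. For $i<4$, the right side of $R_i$ is glued to the left side of $R_{i+1}$ at heights $0\le y\le a_i$. For $1\le i\le 4$ with $\sigma(i)\neq 4$, the right side of $R_i$ at heights $a_i\le y\le h_i$ is glued to the left side of $R_{\sigma(i)+1}$ at heights $y-a_i+a_{\sigma(i)}$. The top of each $R_i$ is glued to the part of $X$ that the interval exchange with lengths $\lambda$ and permutation $\pi$ assigns to the $i$-th interval. The cone point of $S$ is represented by $x_0,\dots,x_4$, where $x_i$ lies at height $a_i$ on the right side of $R_i$ (for $i\ge 1$) and on the left side of $R_{i+1}$ (for $i\le 3$). A saddle connection is a straight trajectory on $S$ from the cone point to itself with no cone point in its interior. Consider the saddle connections on $S$ that have positive (finite) slope and whose holonomy vector has horizontal component in $(0,1]$. If $$\sum_{i=1}^4\lambda_i+\min_{1\le i\le 4}\lambda_i>1,$$ then a saddle connection whose slope is smallest among these does not pass through the top of a rectangle: no point of it other than its two endpoints lies on the top side of any $R_i$. -/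

import Mathlib

open Finset

/-! Zippered rectangles over a four-interval exchange, for surfaces with a single cone point of
angle `6π`. Rectangles are indexed by `Fin 4` (so `i` is the `(i+1)`-st rectangle `R_{i+1}`) and the
cone points `x_0, …, x_4` by `Fin 5`. Rectangle `i` has `x_{i.castSucc}` on its left side and
`x_{i.succ}` on its right side. -/

/-- The Rauzy class of `π₀`: everything obtained from `π₀` by the two moves of Rauzy induction.
Here `π j` is the place of the `j`-th interval after the exchange. -/
inductive RauzyClass (π₀ : Equiv.Perm (Fin 4)) : Equiv.Perm (Fin 4) → Prop
  | base : RauzyClass π₀ π₀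
  | top {π π' : Equiv.Perm (Fin 4)} (hπ : RauzyClass π₀ π)
      (h : ∀ j, π' j = if j ≤ π.symm 3 then π j
        else if j = π.symm 3 + 1 then π 3 else π (j - 1)) : RauzyClass π₀ π'
  | bottom {π π' : Equiv.Perm (Fin 4)} (hπ : RauzyClass π₀ π)
      (h : ∀ j, π' j = if π j ≤ π 3 then π j
        else if π j = 3 then π 3 + 1 else π j + 1) : RauzyClass π₀ π'

/-- The auxiliary map `σ` of `π` on the indices `0, …, 4` of the cone points (intervals and places
being numbered from `1`): `σ(0) = π⁻¹(1) - 1`, `σ(π⁻¹(4)) = 4`, and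
`σ(j) = π⁻¹(π(j) + 1) - 1` otherwise. -/
def sigma (π : Equiv.Perm (Fin 4)) : Fin 5 → Fin 5 :=
  Fin.cases (π.symm 0).castSucc
    (fun i => if π i = 3 then Fin.last 4 else (π.symm (π i + 1)).castSucc)

/-- The data `(π; a, h, λ)` of a zippered rectangle surface of area one in the stratum with one
cone point of angle `6π`, built over a horizontal transversal of length at most one that joins
two cone points. The heights carry the dummy components `h 0 = h 5 = 0`. -/
structure ZipperedRectangles where
  π : Equiv.Perm (Fin 4)
  a : Fin 5 → ℝ
  h : Fin 6 → ℝ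
  lam : Fin 4 → ℝ
  /-- `π` is in the Rauzy class of the order-reversing permutation `(4321)`. -/
  rauzy : RauzyClass Fin.revPerm π
  h_first : h 0 = 0
  h_last : h 5 = 0
  a_first : a 0 = 0
  /-- The transversal ends at a cone point. -/
  a_last : a 4 = 0
  a_pos : ∀ i : Fin 5, i ≠ 0 → i ≠ 4 → 0 < a i
  lam_pos : ∀ i, 0 < lam i
  h_sub_a : ∀ j : Fin 5, h j.castSucc - a j = h (sigma π j).succ - a (sigma π j)
  h_nonneg : ∀ i : Fin 4, 0 ≤ h i.succ.castSucc
  a_nonneg : ∀ i : Fin 4, 0 ≤ a i.succ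
  a_last_le : a 4 ≤ h 4
  neg_le_a_last : -h (π.symm 3).succ.castSucc ≤ a 4
  a_le_next : a (π.symm 3).succ ≤ h (π.symm 3).succ.succ
  a_le_min : ∀ i : Fin 4, i ≠ 3 → i ≠ π.symm 3 →
    a i.succ ≤ min (h i.succ.castSucc) (h i.succ.succ)
  area_eq_one : ∑ i, lam i * h i.succ.castSucc = 1
  sum_lam_le_one : ∑ i, lam i ≤ 1

namespace ZipperedRectangles

variable (Z : ZipperedRectangles)

/-- The height of rectangle `i`. -/
def height (i : Fin 4) : ℝ := Z.h i.succ.castSucc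

/-- The horizontal position on the transversal of the left end of the bottom of rectangle `i`. -/
def bottomStart (i : Fin 4) : ℝ := ∑ k with k < i, Z.lam k

/-- The horizontal position on the transversal of the left end of the top of rectangle `i`. -/
def topStart (i : Fin 4) : ℝ := ∑ k with Z.π k < Z.π i, Z.lam k

/-- The point `(i, x, y)` lies in the closed rectangle `i`; the coordinates `x`, `y` are taken from
the lower left corner of that rectangle. -/
def Mem (P : Fin 4 × ℝ × ℝ) : Prop :=
  P.2.1 ∈ Set.Icc 0 (Z.lam P.1) ∧ P.2.2 ∈ Set.Icc 0 (Z.height P.1)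

/-- The side identifications, all of them translations, that turn the disjoint union of the four
rectangles into the surface. -/
inductive Glue : Fin 4 × ℝ × ℝ → Fin 4 × ℝ × ℝ → Prop
  /-- Below the cone point on its right side, a rectangle is glued to its right neighbour. -/
  | wall (i j : Fin 4) (y : ℝ) (hij : j.castSucc = i.succ) (h0 : 0 ≤ y) (h1 : y ≤ Z.a i.succ) :
      Glue (i, Z.lam i, y) (j, 0, y)
  /-- Above the cone point on its right side, `R_i` is glued to `R_{σ(i)+1}`. -/
  | zip (i j : Fin 4) (y : ℝ) (hij : j.castSucc = sigma Z.π i.succ) (h0 : Z.a i.succ ≤ y)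
      (h1 : y ≤ Z.height i) :
      Glue (i, Z.lam i, y) (j, 0, y - Z.a i.succ + Z.a j.castSucc)
  /-- The top of each rectangle is glued to the transversal, the union of all the bottoms. -/
  | roof (i j : Fin 4) (x x' : ℝ) (hx : x ∈ Set.Icc 0 (Z.lam i)) (hx' : x' ∈ Set.Icc 0 (Z.lam j))
      (h : Z.topStart i + x = Z.bottomStart j + x') :
      Glue (i, x, Z.height i) (j, x', 0)

/-- The point represents a cone point: on the glued surface it is one of `x_0, …, x_4`, which sit
on the left and on the right sides of the rectangles at the altitudes `a`. -/
def IsCone (P : Fin 4 × ℝ × ℝ) : Prop :=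
  ∃ i : Fin 4, Relation.EqvGen Z.Glue P (i, 0, Z.a i.castSucc) ∨
    Relation.EqvGen Z.Glue P (i, Z.lam i, Z.a i.succ)

/-- A saddle connection of positive slope, traversed from left to right: a straight trajectory
from a cone point to a cone point without cone points in its interior. It is cut into its segments
in the rectangles: segment `k` lies in rectangle `rect k`, starts at `(x k, y k)`, has horizontal
extent `width k`, and is continued by segment `k + 1` through a side identification. -/
structure SaddleConnection where
  n : ℕ
  rect : Fin (n + 1) → Fin 4
  x : Fin (n + 1) → ℝ
  y : Fin (n + 1) → ℝ
  width : Fin (n + 1) → ℝ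
  slope : ℝ
  slope_pos : 0 < slope
  width_pos : ∀ k, 0 < width k
  mem : ∀ k, ∀ t ∈ Set.Icc 0 (width k), Z.Mem (rect k, x k + t, y k + slope * t)
  glue : ∀ k : Fin n,
    Z.Glue (rect k.castSucc, x k.castSucc + width k.castSucc,
        y k.castSucc + slope * width k.castSucc)
      (rect k.succ, x k.succ, y k.succ)
  start_cone : Z.IsCone (rect 0, x 0, y 0)
  end_cone : Z.IsCone (rect (Fin.last n), x (Fin.last n) + width (Fin.last n),
    y (Fin.last n) + slope * width (Fin.last n))
  interior : ∀ k, ∀ t ∈ Set.Icc 0 (width k), Z.IsCone (rect k, x k + t, y k + slope * t) →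
    (k = 0 ∧ t = 0) ∨ (k = Fin.last n ∧ t = width k)

namespace SaddleConnection

variable {Z}

/-- The horizontal component of the holonomy vector. -/
def horizontal (γ : Z.SaddleConnection) : ℝ := ∑ k, γ.width k

/-- Some point of the saddle connection other than its two ends lies on the top side of a
rectangle. -/
def PassesThroughTop (γ : Z.SaddleConnection) : Prop :=
  ∃ k, ∃ t ∈ Set.Icc 0 (γ.width k), γ.y k + γ.slope * t = Z.height (γ.rect k) ∧
    ¬ (k = 0 ∧ t = 0) ∧ ¬ (k = Fin.last γ.n ∧ t = γ.width k)

/-- `γ` has smallest slope among the saddle connections of positive slope whose horizontal component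
is at most one. -/
def HasSmallestSlope (γ : Z.SaddleConnection) : Prop :=
  γ.horizontal ≤ 1 ∧ ∀ γ' : Z.SaddleConnection, γ'.horizontal ≤ 1 → γ.slope ≤ γ'.slope

end SaddleConnection

end ZipperedRectangles

/-!
Suppose that a saddle connection `γ` of smallest slope `s` passes through a top, and let it do so
for the first time at the position `p` of the transversal `X`. Two facts are in conflict.

* After this crossing `γ` still travels a horizontal distance of at least `|X| - p`
  (`SaddleConnection.length_sub_le_sum_width`). Among the lines from the left end of `X` to the cone
  points `x_1, x_2, x_3` above it, one of smallest slope is a saddle connection over `X`, of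
  horizontal component at most `|X| ≤ 1`. So `s` is at most the slope of each of these lines
  (`SaddleConnection.HasSmallestSlope.mul_le`), and `γ`, which starts at `p > 0`, passes under all
  three points into the last rectangle. On the right side of this rectangle it has travelled
  `|X| - p`. If it reaches the top before, it crosses `X` again, and the argument is repeated: the
  place of the last interval after the exchange is not to the right of the one before, so no
  distance is lost. It can end on the top only at its right corner.
* Let `U` be the horizontal distance from the start of `γ` to the crossing. The triangle with
  vertices at the start of `γ`, the crossing and the right end of `X` develops into the plane below
  `γ` and `X`. Among the lines from the start to
  the right end of `X` and to those cone points below `γ` and `X` that lie on the vertical sides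
  crossed by `γ` or ending on `X`, one of largest slope is a saddle connection. Its slope
  is positive and smaller than `s`, and its horizontal component is at most `U + |X| - p`
  (`SaddleConnection.exists_slope_lt_of_first_top`).

By the first fact `U + |X| - p` is at most the horizontal component of `γ`, hence at most one, and
the second saddle connection contradicts the choice of `γ`.

Such lines are shown to be saddle connections in `exists_saddleConnection_of_corridor`. That they
have no cone point in their interior rests on `IsCone.coneLike`: off the horizontal sides the only
representatives of cone points are the evident ones, and on the transversal cone points lie only at
the ends of exchanged intervals.
-/

namespace ZipperedRectangles

variable (Z : ZipperedRectangles)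

/-! ### Heights and positions -/

theorem height_sub_a_succ {i j : Fin 4} (hij : j.castSucc = sigma Z.π i.succ) :
    Z.height i - Z.a i.succ = Z.height j - Z.a j.castSucc := by
  have := Z.h_sub_a i.succ
  rw [← hij] at this
  simpa [height] using this

theorem a_succ_eq_height {i : Fin 4} (hi : Z.π i = 3) : Z.a i.succ = Z.height i := by
  have h := Z.h_sub_a i.succ
  have hs : sigma Z.π i.succ = Fin.last 4 := by simp [sigma, hi]
  have h5 : Z.h (Fin.last 4).succ = 0 := Z.h_last
  have h4 : Z.a (Fin.last 4) = 0 := Z.a_last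
  rw [hs, h5, h4] at h
  simp only [height]
  linarith

theorem a_succ_nonneg (i : Fin 4) : 0 ≤ Z.a i.succ := Z.a_nonneg i

theorem a_castSucc_nonneg (i : Fin 4) : 0 ≤ Z.a i.castSucc := by
  refine Fin.cases ?_ (fun k => ?_) i
  · exact Z.a_first.ge
  · exact Z.a_nonneg k.castSucc

theorem a_succ_le_height (i : Fin 4) : Z.a i.succ ≤ Z.height i := by
  by_cases hi : Z.π i = 3
  · exact (Z.a_succ_eq_height hi).le
  by_cases h3 : i = 3
  · subst h3
    exact Z.a_last_le
  · exact (Z.a_le_min i h3 fun h => hi (by rw [h]; simp)).trans (min_le_left _ _)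

theorem a_castSucc_le_height {i j : Fin 4} (hij : j.castSucc = i.succ) :
    Z.a i.succ ≤ Z.height j := by
  have hj : Z.height j = Z.h i.succ.succ := by
    rw [← hij]; simp [height]
  have h3 : i ≠ 3 := by
    rintro rfl
    exact absurd hij (Fin.castSucc_lt_last j).ne
  rw [hj]
  by_cases hi : i = Z.π.symm 3
  · rw [hi]; exact Z.a_le_next
  · exact (Z.a_le_min i h3 hi).trans (min_le_right _ _)

/-- The length of the transversal. -/
def length : ℝ := ∑ i, Z.lam i

theorem bottomStart_succ {i j : Fin 4} (hij : j.castSucc = i.succ) :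
    Z.bottomStart j = Z.bottomStart i + Z.lam i := by
  have : (univ.filter fun k => k < j) = insert i (univ.filter fun k => k < i) := by
    ext k
    simp only [mem_filter, mem_univ, true_and, mem_insert]
    simp only [Fin.ext_iff, Fin.lt_def, Fin.val_castSucc, Fin.val_succ] at *
    omega
  rw [bottomStart, this, sum_insert (by simp), add_comm, bottomStart]

theorem topStart_succ {i j : Fin 4} (hi : Z.π i ≠ 3) (hij : Z.π j = Z.π i + 1) :
    Z.topStart j = Z.topStart i + Z.lam i := by
  have hv : (Z.π j).val = (Z.π i).val + 1 := by
    rw [hij]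
    generalize Z.π i = p at hi
    revert hi; revert p; decide
  have : (univ.filter fun k => Z.π k < Z.π j) = insert i (univ.filter fun k => Z.π k < Z.π i) := by
    ext k
    simp only [mem_filter, mem_univ, true_and, mem_insert, ← Z.π.injective.eq_iff (a := k)]
    simp only [Fin.ext_iff, Fin.lt_def]
    omega
  rw [topStart, this, sum_insert (by simp), add_comm, topStart]

theorem sigma_succ_eq {π : Equiv.Perm (Fin 4)} {i j : Fin 4}
    (hij : j.castSucc = sigma π i.succ) : π i ≠ 3 ∧ π j = π i + 1 := by
  by_cases hi : π i = 3
  · simp only [sigma, Fin.cases_succ, hi, if_true] at hij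
    exact absurd hij (Fin.castSucc_lt_last j).ne
  · simp only [sigma, Fin.cases_succ, hi, if_false] at hij
    exact ⟨hi, by rw [Fin.castSucc_injective 4 hij]; simp⟩

theorem sigma_succ_of_eq {π : Equiv.Perm (Fin 4)} {i j : Fin 4} (hi : π i ≠ 3)
    (hij : π j = π i + 1) : j.castSucc = sigma π i.succ := by
  simp only [sigma, Fin.cases_succ, hi, if_false, ← hij, Equiv.symm_apply_apply]

theorem topStart_add_lam_le {i j : Fin 4} (hij : Z.π i < Z.π j) :
    Z.topStart i + Z.lam i ≤ Z.topStart j := by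
  rw [topStart, topStart, add_comm, ← sum_insert (a := i) (by simp)]
  refine sum_le_sum_of_subset_of_nonneg (fun k => ?_) fun k _ _ => (Z.lam_pos k).le
  simp only [mem_insert, mem_filter, mem_univ, true_and]
  rintro (rfl | h)
  · exact hij
  · exact h.trans hij

theorem topStart_add_lam_of_last {i : Fin 4} (hi : Z.π i = 3) :
    Z.topStart i + Z.lam i = Z.length := by
  rw [topStart, length, add_comm, ← sum_insert (a := i) (by simp)]
  congr 1
  ext k
  simp only [mem_insert, mem_filter, mem_univ, true_and, iff_true,
    ← Z.π.injective.eq_iff (a := k), hi]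
  generalize Z.π k = p
  revert p; decide

theorem bottomStart_three : Z.bottomStart 3 + Z.lam 3 = Z.length := by
  rw [bottomStart, length, add_comm, ← sum_insert (a := 3) (by simp)]
  congr 1
  decide

theorem topStart_nonneg (i : Fin 4) : 0 ≤ Z.topStart i :=
  sum_nonneg fun k _ => (Z.lam_pos k).le

theorem bottomStart_nonneg (i : Fin 4) : 0 ≤ Z.bottomStart i :=
  sum_nonneg fun k _ => (Z.lam_pos k).le

theorem topStart_add_lam_le_length (i : Fin 4) : Z.topStart i + Z.lam i ≤ Z.length := by
  rw [topStart, length, add_comm, ← sum_insert (a := i) (by simp)]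
  exact sum_le_sum_of_subset_of_nonneg (subset_univ _) fun k _ _ => (Z.lam_pos k).le

theorem bottomStart_add_lam_le_length (i : Fin 4) : Z.bottomStart i + Z.lam i ≤ Z.length := by
  rw [bottomStart, length, add_comm, ← sum_insert (a := i) (by simp)]
  exact sum_le_sum_of_subset_of_nonneg (subset_univ _) fun k _ _ => (Z.lam_pos k).le

/-! ### Where the cone points are -/

/-- A position on the transversal that is not in the interior of one of the four exchanged
intervals. -/
def IsBreak (e : ℝ) : Prop := ∀ j, ¬ (Z.topStart j < e ∧ e < Z.topStart j + Z.lam j)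

theorem isBreak_topStart (i : Fin 4) : Z.IsBreak (Z.topStart i) := by
  rintro j ⟨h1, h2⟩
  rcases lt_trichotomy (Z.π i) (Z.π j) with h | h | h
  · have := Z.topStart_add_lam_le h
    have := Z.lam_pos i
    linarith
  · rw [Z.π.injective h] at h1
    exact lt_irrefl _ h1
  · have := Z.topStart_add_lam_le h
    linarith

theorem isBreak_topEnd (i : Fin 4) : Z.IsBreak (Z.topStart i + Z.lam i) := by
  rintro j ⟨h1, h2⟩
  rcases lt_trichotomy (Z.π i) (Z.π j) with h | h | h
  · have := Z.topStart_add_lam_le h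
    linarith
  · rw [Z.π.injective h] at h2
    exact lt_irrefl _ h2
  · have := Z.topStart_add_lam_le h
    have := Z.lam_pos i
    linarith

theorem isBreak_zero : Z.IsBreak 0 := fun j h => (Z.topStart_nonneg j).not_gt h.1

theorem isBreak_length : Z.IsBreak Z.length :=
  fun j h => (Z.topStart_add_lam_le_length j).not_gt h.2

/-- A necessary condition for a point to be a cone point, which the side identifications respect:
on the transversal (a bottom or a top) the position is a break point of the exchange, and elsewhere
the point is one of the cone points on the vertical sides. -/
def ConeLike (P : Fin 4 × ℝ × ℝ) : Prop :=
  (P.2.2 = 0 → Z.IsBreak (Z.bottomStart P.1 + P.2.1)) ∧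
  (P.2.2 = Z.height P.1 → Z.IsBreak (Z.topStart P.1 + P.2.1)) ∧
  (0 < P.2.2 → P.2.2 < Z.height P.1 →
    P.2.1 = 0 ∧ P.2.2 = Z.a P.1.castSucc ∨ P.2.1 = Z.lam P.1 ∧ P.2.2 = Z.a P.1.succ)

theorem a_succ_pos {i : Fin 4} (hi : i ≠ 3) : 0 < Z.a i.succ :=
  Z.a_pos _ (Fin.succ_ne_zero i) fun h => hi (Fin.succ_injective _ (h.trans rfl))

theorem height_pos (i : Fin 4) : 0 < Z.height i := by
  by_cases hi : i = 3
  · subst hi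
    exact (Z.a_succ_pos (i := 2) (by decide)).trans_le (Z.a_castSucc_le_height rfl)
  · exact (Z.a_succ_pos hi).trans_le (Z.a_succ_le_height i)

theorem coneLike_left (i : Fin 4) : Z.ConeLike (i, 0, Z.a i.castSucc) := by
  refine ⟨fun h => ?_, fun _ => ?_, fun _ _ => Or.inl ⟨rfl, rfl⟩⟩
  · obtain rfl : i = 0 := by
      by_contra hi
      exact (Z.a_pos i.castSucc (by simpa using hi) (Fin.castSucc_lt_last i).ne).ne' h
    simpa [bottomStart] using Z.isBreak_zero
  · simpa using Z.isBreak_topStart i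

theorem coneLike_right (i : Fin 4) : Z.ConeLike (i, Z.lam i, Z.a i.succ) := by
  refine ⟨fun h => ?_, fun _ => Z.isBreak_topEnd i, fun _ _ => Or.inr ⟨rfl, rfl⟩⟩
  obtain rfl : i = 3 := by
    by_contra hi
    exact (Z.a_succ_pos hi).ne' h
  simpa [Z.bottomStart_three] using Z.isBreak_length

theorem coneLike_iff_of_glue {P Q : Fin 4 × ℝ × ℝ} (h : Z.Glue P Q) :
    Z.ConeLike P ↔ Z.ConeLike Q := by
  cases h with
  | wall i j y hij h0 h1 =>
    rcases eq_or_lt_of_le h1 with rfl | h1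
    · have := Z.coneLike_left j
      rw [hij] at this
      exact iff_of_true (Z.coneLike_right i) this
    have hi := h1.trans_le (Z.a_succ_le_height i)
    have hj := h1.trans_le (Z.a_castSucc_le_height hij)
    have hli := Z.lam_pos i
    have hlj := Z.lam_pos j
    simp only [ConeLike, hij, hi.ne, hj.ne, h1.ne, hi, hj, hli.ne', hlj.ne,
      Z.bottomStart_succ hij, add_zero, and_false, or_false, true_implies]
    tauto
  | zip i j y hij h0 h1 =>
    rcases eq_or_lt_of_le h0 with rfl | h0
    · have := Z.coneLike_left j
      simpa using iff_of_true (Z.coneLike_right i) this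
    have hd := Z.height_sub_a_succ hij
    obtain ⟨hi3, hπ⟩ := sigma_succ_eq hij
    have hai := Z.a_succ_nonneg i
    have haj := Z.a_castSucc_nonneg j
    have e1 : y ≠ 0 := by linarith
    have e2 : y - Z.a i.succ + Z.a j.castSucc ≠ 0 := by linarith
    have e3 : 0 < y := by linarith
    have e4 : 0 < y - Z.a i.succ + Z.a j.castSucc := by linarith
    have e5 : y - Z.a i.succ + Z.a j.castSucc = Z.height j ↔ y = Z.height i := by
      constructor <;> intro <;> linarith
    have e6 : y - Z.a i.succ + Z.a j.castSucc < Z.height j ↔ y < Z.height i := by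
      constructor <;> intro <;> linarith
    have e7 : y - Z.a i.succ + Z.a j.castSucc ≠ Z.a j.castSucc := by linarith
    have hli := Z.lam_pos i
    have hlj := Z.lam_pos j
    simp only [ConeLike, e1, e2, e3, e4, e5, e6, e7, h0.ne', hli.ne', hlj.ne,
      Z.topStart_succ hi3 hπ, add_zero, and_false, false_and, or_false, true_implies]
    tauto
  | roof i j x x' hx hx' h =>
    have hi := Z.height_pos i
    have hj := Z.height_pos j
    simp only [ConeLike, hi.ne', hj.ne, h, lt_irrefl]
    tauto

theorem IsCone.coneLike {Z : ZipperedRectangles} {P : Fin 4 × ℝ × ℝ} (h : Z.IsCone P) :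
    Z.ConeLike P := by
  have key : ∀ {P Q}, Relation.EqvGen Z.Glue P Q → (Z.ConeLike P ↔ Z.ConeLike Q) := by
    intro P Q h
    induction h with
    | rel _ _ h => exact Z.coneLike_iff_of_glue h
    | refl => rfl
    | symm _ _ _ ih => exact ih.symm
    | trans _ _ _ _ _ ih₁ ih₂ => exact ih₁.trans ih₂
  obtain ⟨i, h | h⟩ := h
  · exact (key h).2 (Z.coneLike_left i)
  · exact (key h).2 (Z.coneLike_right i)

theorem isCone_left (i : Fin 4) : Z.IsCone (i, 0, Z.a i.castSucc) :=
  ⟨i, Or.inl (.refl _)⟩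

theorem isCone_right (i : Fin 4) : Z.IsCone (i, Z.lam i, Z.a i.succ) :=
  ⟨i, Or.inr (.refl _)⟩

theorem IsCone.of_glue {Z : ZipperedRectangles} {P Q : Fin 4 × ℝ × ℝ} (hPQ : Z.Glue P Q)
    (h : Z.IsCone Q) : Z.IsCone P := by
  obtain ⟨i, h | h⟩ := h
  · exact ⟨i, Or.inl (.trans _ _ _ (.rel _ _ hPQ) h)⟩
  · exact ⟨i, Or.inr (.trans _ _ _ (.rel _ _ hPQ) h)⟩

/-! ### Lines through corridors of rectangles -/

/-- A corridor of rectangles, each leading into the next through its right side, together with a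
line of slope `m` that starts at a cone point, avoids the cone points on the sides it crosses and
reaches the cone point on the right side of the last rectangle, is a saddle connection. -/
theorem exists_saddleConnection_of_corridor (n : ℕ) (ρ : ℕ → Fin 4) (x y : ℕ → ℝ) {m : ℝ}
    (hm : 0 < m) (hx0 : 0 ≤ x 0) (hxlam : x 0 < Z.lam (ρ 0)) (hx : ∀ k, x (k + 1) = 0)
    (hy0 : 0 ≤ y 0) (hstart : Z.IsCone (ρ 0, x 0, y 0))
    (edge : ∀ k < n,
      ((ρ (k + 1)).castSucc = (ρ k).succ ∧ y (k + 1) = y k + m * (Z.lam (ρ k) - x k) ∧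
        y k + m * (Z.lam (ρ k) - x k) < Z.a (ρ k).succ) ∨
      ((ρ (k + 1)).castSucc = sigma Z.π (ρ k).succ ∧
        y (k + 1) = y k + m * (Z.lam (ρ k) - x k) - Z.a (ρ k).succ + Z.a (ρ (k + 1)).castSucc ∧
        Z.a (ρ k).succ < y k + m * (Z.lam (ρ k) - x k) ∧
        y k + m * (Z.lam (ρ k) - x k) < Z.height (ρ k)))
    (hend : y n + m * (Z.lam (ρ n) - x n) = Z.a (ρ n).succ) :
    ∃ γ : Z.SaddleConnection, γ.slope = m ∧
      γ.horizontal = ∑ k ∈ range (n + 1), (Z.lam (ρ k) - x k) := by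
  have hw : ∀ k, 0 < Z.lam (ρ k) - x k := by
    rintro (_ | k)
    · linarith
    · rw [hx k, sub_zero]; exact Z.lam_pos _
  have hxn : ∀ k, 0 ≤ x k := by
    rintro (_ | k)
    · exact hx0
    · exact (hx k).ge
  have hy : ∀ k ≤ n, 0 ≤ y k ∧ (k ≠ 0 → 0 < y k) := by
    intro k
    induction k with
    | zero => exact fun _ => ⟨hy0, fun h => absurd rfl h⟩
    | succ k ih =>
      intro hk
      have h1 := (ih (by omega)).1
      have h2 := mul_pos hm (hw k)
      have h3 := Z.a_castSucc_nonneg (ρ (k + 1))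
      have : 0 < y (k + 1) := by
        rcases edge k (by omega) with ⟨-, h, -⟩ | ⟨-, h, h', -⟩ <;> linarith
      exact ⟨this.le, fun _ => this⟩
  have htop : ∀ k < n, y k + m * (Z.lam (ρ k) - x k) < Z.height (ρ k) := by
    intro k hk
    rcases edge k hk with ⟨-, -, h⟩ | ⟨-, -, -, h⟩
    · exact h.trans_le (Z.a_succ_le_height _)
    · exact h
  have htop' : ∀ k ≤ n, y k + m * (Z.lam (ρ k) - x k) ≤ Z.height (ρ k) := by
    intro k hk
    rcases hk.lt_or_eq with h | rfl
    · exact (htop k h).le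
    · exact hend.le.trans (Z.a_succ_le_height _)
  have hglue : ∀ k < n, Z.Glue (ρ k, x k + (Z.lam (ρ k) - x k), y k + m * (Z.lam (ρ k) - x k))
      (ρ (k + 1), x (k + 1), y (k + 1)) := by
    intro k hk
    rw [hx k, add_sub_cancel]
    rcases edge k hk with ⟨h1, h2, h3⟩ | ⟨h1, h2, h3, h4⟩
    · rw [h2]
      exact .wall _ _ _ h1 (add_nonneg (hy k hk.le).1 (mul_pos hm (hw k)).le) h3.le
    · rw [h2]
      exact .zip _ _ _ h1 h3.le h4.le
  -- On the closed segment `k` without its left end, the line is below the top of the rectangle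
  -- and misses the cone point on the right side, except at the very end.
  have hcone : ∀ k ≤ n, ∀ t, 0 < t → t ≤ Z.lam (ρ k) - x k →
      Z.IsCone (ρ k, x k + t, y k + m * t) → k = n ∧ t = Z.lam (ρ k) - x k := by
    intro k hk t ht0 ht hc
    by_contra hne
    have hmt : m * t ≤ m * (Z.lam (ρ k) - x k) := mul_le_mul_of_nonneg_left ht hm.le
    have h0 : 0 < y k + m * t := add_pos_of_nonneg_of_pos (hy k hk).1 (mul_pos hm ht0)
    have h1 : y k + m * t < Z.height (ρ k) := by
      rcases hk.lt_or_eq with h | rfl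
      · linarith [htop k h]
      · have : m * t < m * (Z.lam (ρ k) - x k) :=
          mul_lt_mul_of_pos_left (lt_of_le_of_ne ht fun h => hne ⟨rfl, h⟩) hm
        linarith [htop' k le_rfl]
    rcases hc.coneLike.2.2 h0 h1 with ⟨h, -⟩ | ⟨h, h'⟩
    · have := hxn k
      simp only at h
      linarith
    · simp only at h h'
      have ht' : t = Z.lam (ρ k) - x k := by linarith
      have hkn : k < n := lt_of_le_of_ne hk fun h => hne ⟨h, ht'⟩
      rw [ht'] at h'
      rcases edge k hkn with ⟨-, -, h⟩ | ⟨-, -, h, -⟩ <;> linarith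
  refine ⟨⟨n, fun k => ρ k, fun k => x k, fun k => y k, fun k => Z.lam (ρ k) - x k, m, hm,
    fun k => hw k, fun k t ht => ?_, fun k => ?_, hstart, ?_, fun k t ht hc => ?_⟩, rfl, ?_⟩
  · have hk : (k : ℕ) ≤ n := Nat.lt_succ_iff.1 k.2
    have h1 := mul_nonneg hm.le ht.1
    have h2 := mul_le_mul_of_nonneg_left ht.2 hm.le
    have h3 := htop' k hk
    have h4 := (hy k hk).1
    have h5 := hxn k
    have h6 := ht.1
    have h7 := ht.2
    simp only [Mem, Set.mem_Icc]
    refine ⟨⟨?_, ?_⟩, ?_, ?_⟩ <;> linarith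
  · simpa using hglue k k.2
  · have := Z.isCone_right (ρ n)
    rw [← hend] at this
    simpa using this
  · have hk : (k : ℕ) ≤ n := Nat.lt_succ_iff.1 k.2
    rcases ht.1.eq_or_lt with rfl | ht0
    · rcases Nat.eq_zero_or_pos (k : ℕ) with h | h
      · exact Or.inl ⟨Fin.ext h, rfl⟩
      · -- The left end of a later segment is the right end of the previous one.
        obtain ⟨l, hl⟩ := Nat.exists_eq_add_of_lt h
        rw [zero_add] at hl
        have hln : l < n := by omega
        rw [mul_zero, add_zero, add_zero, hl] at hc
        exact absurd (hcone l hln.le _ (hw l) le_rfl (hc.of_glue (hglue l hln))).1 hln.ne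
    · obtain ⟨h1, h2⟩ := hcone k hk t ht0 ht.2 hc
      exact Or.inr ⟨Fin.ext h1, h2⟩
  · exact (Fin.sum_univ_eq_sum_range (fun k => Z.lam (ρ k) - x k) (n + 1))

/-- Among finitely many indices there is a first one at which `f` is maximal. -/
theorem exists_first_max {α : Type*} [LinearOrder α] (s : Finset ℕ) (hs : s.Nonempty)
    (f : ℕ → α) :
    ∃ r ∈ s, (∀ k ∈ s, f k ≤ f r) ∧ ∀ k ∈ s, k < r → f k < f r := by
  classical
  have h : ∃ r, r ∈ s ∧ ∀ k ∈ s, f k ≤ f r := by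
    obtain ⟨r, h⟩ := s.exists_max_image f hs
    exact ⟨r, h⟩
  refine ⟨Nat.find h, (Nat.find_spec h).1, (Nat.find_spec h).2, fun k hk hlt => ?_⟩
  by_contra hle
  exact Nat.find_min h hlt ⟨hk, fun l hl => ((Nat.find_spec h).2 l hl).trans (not_lt.1 hle)⟩

/-! ### Saddle connections over the transversal -/

/-- The smallest slope is at most the slope of the line from the left end of the transversal to each
of the cone points `x_1, x_2, x_3`: a line of smallest slope among these three runs under the other
cone points, so it is a saddle connection, and it extends no further than the transversal. -/
theorem SaddleConnection.HasSmallestSlope.mul_le {Z : ZipperedRectangles}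
    {γ : Z.SaddleConnection} (hγ : γ.HasSmallestSlope) {i : Fin 4} (hi : i ≠ 3) :
    γ.slope * (Z.bottomStart i + Z.lam i) ≤ Z.a i.succ := by
  let B : Fin 4 → ℝ := fun i => Z.bottomStart i + Z.lam i
  have hB : ∀ i, 0 < B i := fun i =>
    add_pos_of_nonneg_of_pos (Z.bottomStart_nonneg i) (Z.lam_pos i)
  let ρ : ℕ → Fin 4 := fun k => Fin.ofNat 4 k
  -- Ties go to the first cone point, so that the line does not meet another one before it.
  let f : ℕ → ℝ := fun k => -(Z.a (ρ k).succ / B (ρ k))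
  obtain ⟨r, hr, hmax, hfirst⟩ := exists_first_max (range 3) ⟨0, by simp⟩ f
  have hr3 : r < 3 := mem_range.1 hr
  have hstep : ∀ k < r, (ρ (k + 1)).castSucc = (ρ k).succ := by
    intro k hk
    ext
    simp only [ρ, Fin.val_castSucc, Fin.val_succ, Fin.val_ofNat]
    omega
  have hr3' : ρ r ≠ 3 := by
    intro h
    have := congrArg Fin.val h
    simp only [ρ, Fin.val_ofNat] at this
    change r % 4 = 3 at this
    omega
  set m := Z.a (ρ r).succ / B (ρ r) with hm
  have hmpos : 0 < m := div_pos (Z.a_succ_pos hr3') (hB _)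
  have hb0 : Z.bottomStart (ρ 0) = 0 := by simp [ρ, bottomStart]
  obtain ⟨γ', hs, hh⟩ := Z.exists_saddleConnection_of_corridor r ρ (fun _ => 0)
    (fun k => m * Z.bottomStart (ρ k)) hmpos le_rfl (Z.lam_pos _) (fun _ => rfl)
    (by simp [hb0])
    (by
      have := Z.isCone_left (ρ 0)
      rw [hb0, mul_zero]
      rwa [show Z.a (ρ 0).castSucc = 0 from Z.a_first] at this)
    (fun k hk => Or.inl ⟨hstep k hk, by rw [Z.bottomStart_succ (hstep k hk)]; ring, by
      have := hfirst k (mem_range.2 (by omega)) hk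
      have h : m < Z.a (ρ k).succ / B (ρ k) := by simpa [f] using this
      rw [lt_div_iff₀ (hB _)] at h
      simp only [B] at h
      linarith⟩)
    (by
      rw [hm, sub_zero, ← mul_add]
      exact div_mul_cancel₀ _ (hB _).ne')
  have hsum : ∀ k ≤ r, ∑ l ∈ range k, Z.lam (ρ l) = Z.bottomStart (ρ k) := by
    intro k
    induction k with
    | zero => simp [hb0]
    | succ k ih =>
      intro hk
      rw [sum_range_succ, ih (by omega), Z.bottomStart_succ (hstep k hk)]
  have hle : γ.slope ≤ m := by
    rw [← hs]
    refine hγ.2 γ' ?_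
    simp only [sub_zero] at hh
    rw [hh, sum_range_succ, hsum r le_rfl]
    exact (Z.bottomStart_add_lam_le_length _).trans Z.sum_lam_le_one
  have hρi : ρ i = i := by simp [ρ]
  have hi3 : (i : ℕ) < 3 := by
    have : (i : ℕ) ≠ 3 := fun h => hi (Fin.ext h)
    omega
  have := hmax i (mem_range.2 hi3)
  simp only [f, hρi, neg_le_neg_iff] at this
  exact (le_div_iff₀ (hB i)).1 (hle.trans this)

/-! ### Tightening below a line -/

/-- Tightening of a line to a saddle connection below it. A corridor of rectangles is developed in
the plane, rectangle `r` having its bottom at altitude `b r`. The steep line of slope `s` from a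
cone point at altitude `y₀` passes below the cone point of each side which the corridor crosses
below that point, and above all other ones, the last one included. Among the lines from the start
to the cone points below the steep line, one of maximal slope stays in the corridor and is a saddle
connection. -/
theorem exists_saddleConnection_slope_lt (N : ℕ) (ρ : ℕ → Fin 4) (x b W : ℕ → ℝ) {s y₀ : ℝ}
    (hx0 : 0 ≤ x 0) (hxlam : x 0 < Z.lam (ρ 0)) (hx : ∀ k, x (k + 1) = 0)
    (hW : ∀ k, W k = ∑ l ∈ range k, (Z.lam (ρ l) - x l))
    (hb : b 0 = 0) (hy₀ : 0 ≤ y₀) (hstart : Z.IsCone (ρ 0, x 0, y₀))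
    (edge : ∀ k < N,
      ((ρ (k + 1)).castSucc = (ρ k).succ ∧ b (k + 1) = b k ∧
        y₀ + s * W (k + 1) < b k + Z.a (ρ k).succ) ∨
      ((ρ (k + 1)).castSucc = sigma Z.π (ρ k).succ ∧
        b (k + 1) + Z.a (ρ (k + 1)).castSucc = b k + Z.a (ρ k).succ ∧
        b k + Z.a (ρ k).succ < y₀ + s * W (k + 1)))
    (top : ∀ k ≤ N, y₀ + s * W (k + 1) ≤ b k + Z.height (ρ k) ∨
      ∀ l, k ≤ l → l ≤ N → b l + Z.a (ρ l).succ ≤ b k + Z.height (ρ k))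
    (hN : b N + Z.a (ρ N).succ < y₀ + s * W (N + 1)) (hN' : y₀ < b N + Z.a (ρ N).succ) :
    ∃ γ : Z.SaddleConnection, γ.slope < s ∧ γ.horizontal ≤ W (N + 1) := by
  have hw : ∀ k, 0 < Z.lam (ρ k) - x k := by
    rintro (_ | k)
    · linarith
    · rw [hx k, sub_zero]; exact Z.lam_pos _
  have hWs : ∀ k, W (k + 1) = W k + (Z.lam (ρ k) - x k) := fun k => by
    rw [hW, hW, sum_range_succ]
  have hWmono : StrictMono W := strictMono_nat_of_lt_succ fun k => by linarith [hWs k, hw k]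
  have hW0 : W 0 = 0 := by simp [hW]
  have hWpos : ∀ k, 0 < W (k + 1) := fun k => by
    rw [← hW0]; exact hWmono k.succ_pos
  let f : ℕ → ℝ := fun k => (b k + Z.a (ρ k).succ - y₀) / W (k + 1)
  let C : Finset ℕ := (range (N + 1)).filter fun k => b k + Z.a (ρ k).succ < y₀ + s * W (k + 1)
  have hC : ∀ {k}, k ∈ C ↔ k < N + 1 ∧ b k + Z.a (ρ k).succ < y₀ + s * W (k + 1) := by
    simp [C]
  have hNC : N ∈ C := hC.2 ⟨by omega, hN⟩
  obtain ⟨r, hr, hmax, hfirst⟩ := exists_first_max C ⟨N, hNC⟩ f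
  obtain ⟨hrN, hrs⟩ := hC.1 hr
  have hm : 0 < f r := (div_pos (sub_pos.2 hN') (hWpos N)).trans_le (hmax N hNC)
  have hms : f r < s := by
    rw [div_lt_iff₀ (hWpos r)]
    linarith
  have hfr : y₀ + f r * W (r + 1) = b r + Z.a (ρ r).succ := by
    rw [div_mul_cancel₀ _ (hWpos r).ne']
    ring
  have hy : ∀ k, y₀ + f r * W k - b k + f r * (Z.lam (ρ k) - x k) =
      y₀ + f r * W (k + 1) - b k := fun k => by
    rw [hWs]; ring
  have hlt : ∀ k, f r * W (k + 1) < s * W (k + 1) := fun k => mul_lt_mul_of_pos_right hms (hWpos k)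
  obtain ⟨γ, hs, hh⟩ := Z.exists_saddleConnection_of_corridor r ρ x
    (fun k => y₀ + f r * W k - b k) hm hx0 hxlam hx (by simpa [hW0, hb] using hy₀)
    (by simpa [hW0, hb] using hstart)
    (fun k hk => by
      simp only [hy]
      have h1 := hlt k
      rcases edge k (by omega) with ⟨e1, e2, e3⟩ | ⟨e1, e2, e3⟩
      · exact Or.inl ⟨e1, by rw [e2], by linarith⟩
      · have h2 := hfirst k (hC.2 ⟨by omega, e3⟩) hk
        rw [div_lt_iff₀ (hWpos k)] at h2
        refine Or.inr ⟨e1, by linarith, by linarith, ?_⟩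
        rcases top k (by omega) with h | h
        · linarith
        · have h3 := h r hk.le (by omega)
          have h4 : f r * W (k + 1) < f r * W (r + 1) :=
            mul_lt_mul_of_pos_left (hWmono (by omega)) hm
          linarith)
    (by
      simp only [hy]
      linarith)
  refine ⟨γ, hs ▸ hms, ?_⟩
  rw [hh, ← hW]
  exact hWmono.monotone (by omega)

/-! ### The way after a crossing of the transversal -/

theorem Glue.eq_or {Z : ZipperedRectangles} {i j : Fin 4} {x y x' y' : ℝ}
    (h : Z.Glue (i, x, y) (j, x', y')) :
    (j.castSucc = i.succ ∧ x = Z.lam i ∧ x' = 0 ∧ y' = y ∧ y ≤ Z.a i.succ) ∨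
    (j.castSucc = sigma Z.π i.succ ∧ x = Z.lam i ∧ x' = 0 ∧
      y' = y - Z.a i.succ + Z.a j.castSucc ∧ Z.a i.succ ≤ y) ∨
    (y = Z.height i ∧ y' = 0 ∧ Z.topStart i + x = Z.bottomStart j + x') := by
  cases h with
  | wall _ _ _ h _ h1 => exact Or.inl ⟨h, rfl, rfl, rfl, h1⟩
  | zip _ _ _ h h0 _ => exact Or.inr (Or.inl ⟨h, rfl, rfl, rfl, h0⟩)
  | roof _ _ _ _ _ _ h => exact Or.inr (Or.inr ⟨rfl, rfl, h⟩)

namespace SaddleConnection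

variable {Z}

theorem mem_bounds (γ : Z.SaddleConnection) (k : Fin (γ.n + 1)) :
    0 ≤ γ.x k ∧ γ.x k + γ.width k ≤ Z.lam (γ.rect k) ∧ 0 ≤ γ.y k ∧
      γ.y k + γ.slope * γ.width k ≤ Z.height (γ.rect k) := by
  have hw := (γ.width_pos k).le
  have h0 := γ.mem k 0 ⟨le_rfl, hw⟩
  have h1 := γ.mem k _ ⟨hw, le_rfl⟩
  simp only [Mem, add_zero, mul_zero, Set.mem_Icc] at h0 h1
  exact ⟨h0.1.1, h1.1.2, h0.2.1, h1.2.2⟩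

theorem not_isCone_right_end (γ : Z.SaddleConnection) (k : Fin (γ.n + 1))
    (hk : k ≠ Fin.last γ.n) :
    ¬ Z.IsCone (γ.rect k, γ.x k + γ.width k, γ.y k + γ.slope * γ.width k) := by
  intro hc
  rcases γ.interior k _ ⟨(γ.width_pos k).le, le_rfl⟩ hc with ⟨-, h⟩ | ⟨h, -⟩
  · exact (γ.width_pos k).ne' h
  · exact hk h

/-- A saddle connection whose slope is at most the one at which each of `x_1, x_2, x_3` is seen from
the left end of the transversal passes, from any point that lies below the line of its slope from
that end, under these cone points. So it travels at least as far as the right end of the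
transversal. If it leaves through a top on the way, this is the top of the last rectangle, and it
comes back to the transversal at a position that is not further to the right. -/
theorem length_sub_le_sum_width (γ : Z.SaddleConnection)
    (hs : ∀ i : Fin 4, i ≠ 3 → γ.slope * (Z.bottomStart i + Z.lam i) ≤ Z.a i.succ)
    (k : Fin (γ.n + 1)) (hk : γ.y k < γ.slope * (Z.bottomStart (γ.rect k) + γ.x k)) :
    Z.length - (Z.bottomStart (γ.rect k) + γ.x k) ≤ ∑ l ∈ Ici k, γ.width l := by
  have hmem := γ.mem_bounds
  have hpos : ∀ k, 0 < γ.y k + γ.slope * γ.width k := fun k =>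
    add_pos_of_nonneg_of_pos (hmem k).2.2.1 (mul_pos γ.slope_pos (γ.width_pos k))
  -- Right ends of segments below the line lie below the cone point on the right side.
  have hend : ∀ k, γ.y k < γ.slope * (Z.bottomStart (γ.rect k) + γ.x k) → γ.rect k ≠ 3 →
      γ.y k + γ.slope * γ.width k < Z.a (γ.rect k).succ := by
    intro k hk h3
    have h1 := hs _ h3
    have h2 := mul_le_mul_of_nonneg_left (hmem k).2.1 γ.slope_pos.le
    linarith
  have h43 : Z.topStart 3 ≤ Z.bottomStart 3 := by
    have h1 := Z.topStart_add_lam_le_length 3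
    have h2 := Z.bottomStart_three
    linarith
  have hsum : ∀ k : Fin γ.n, ∑ l ∈ Ici k.castSucc, γ.width l =
      γ.width k.castSucc + ∑ l ∈ Ici k.succ, γ.width l := by
    intro k
    have : Ici k.castSucc = insert k.castSucc (Ici k.succ) := by
      ext l
      simp only [mem_Ici, mem_insert, Fin.le_def, Fin.ext_iff, Fin.val_castSucc, Fin.val_succ]
      omega
    rw [this, sum_insert (by simp [Fin.le_def])]
  induction k using Fin.reverseInduction with
  | last =>
    set k := Fin.last γ.n
    have hIci : Ici k = {k} := by
      ext l
      simp only [mem_Ici, mem_singleton]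
      exact ⟨fun h => le_antisymm (Fin.le_last l) h, fun h => h.ge⟩
    rw [hIci, sum_singleton]
    have hw := γ.width_pos k
    obtain ⟨m1, m2, m3, m4⟩ := hmem k
    have hc := γ.end_cone.coneLike
    by_cases h3 : γ.rect k = 3
    · rcases m4.lt_or_eq with h | h
      · rcases hc.2.2 (hpos k) h with ⟨h, -⟩ | ⟨h, -⟩
        · simp only at h
          linarith
        · have h2 := Z.bottomStart_three
          simp only at h
          rw [← h3] at h2
          linarith
      · -- The end is on the top of the last rectangle, so at its right end.
        have hb := hc.2.1 h (γ.rect k)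
        simp only [not_and, not_lt] at hb
        have h1 := hb (by linarith)
        have h2 := Z.bottomStart_three
        rw [← h3] at h2
        linarith
    · have h := hend k hk h3
      rcases hc.2.2 (hpos k) (h.trans_le (Z.a_succ_le_height _)) with ⟨h', -⟩ | ⟨-, h'⟩
      · simp only at h'
        linarith
      · exact absurd h' h.ne
  | cast k ih =>
    rw [hsum]
    obtain ⟨m1, m2, m3, m4⟩ := hmem k.castSucc
    have hw := γ.width_pos k.castSucc
    have hp := hpos k.castSucc
    have he := hend k.castSucc hk
    have hnonneg : 0 ≤ ∑ l ∈ Ici k.succ, γ.width l := sum_nonneg fun l _ => (γ.width_pos l).le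
    rcases (γ.glue k).eq_or with ⟨e1, e2, e3, e4, -⟩ | ⟨-, e2, -, -, e5⟩ | ⟨e1, e2, e3⟩
    · have hB := Z.bottomStart_succ e1
      have := ih (by rw [e3, e4, hB, add_zero, ← e2]; linarith)
      linarith
    · by_cases h3 : γ.rect k.castSucc = 3
      · have h2 := Z.bottomStart_three
        rw [← h3] at h2
        linarith
      · linarith [he h3]
    · by_cases h3 : γ.rect k.castSucc = 3
      · have h0 := Z.topStart_nonneg (γ.rect k.castSucc)
        have := ih (by rw [e2, ← e3]; exact mul_pos γ.slope_pos (by linarith))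
        rw [← h3] at h43
        linarith
      · linarith [he h3, Z.a_succ_le_height (γ.rect k.castSucc)]

/-! ### The triangle before the first crossing of the transversal -/

/-- If a saddle connection leaves its segment `K`, and no earlier one, through a top, then the path
that follows it to this point and then the transversal to its right end tightens, in the triangle
below, to a saddle connection of smaller slope that does not extend further to the right. -/
theorem exists_slope_lt_of_first_top (γ : Z.SaddleConnection) (K : Fin γ.n)
    (hK : γ.y K.castSucc + γ.slope * γ.width K.castSucc = Z.height (γ.rect K.castSucc))
    (hfirst : ∀ k < K, γ.y k.castSucc + γ.slope * γ.width k.castSucc ≠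
      Z.height (γ.rect k.castSucc)) :
    ∃ γ' : Z.SaddleConnection, γ'.slope < γ.slope ∧
      γ'.horizontal ≤ ∑ l ∈ Iic K.castSucc, γ.width l + (Z.length -
        (Z.topStart (γ.rect K.castSucc) + (γ.x K.castSucc + γ.width K.castSucc))) := by
  let G : ℕ → Fin (γ.n + 1) := fun k => Fin.ofNat (γ.n + 1) k
  have hG : ∀ k : Fin (γ.n + 1), G k = k := fun k => by simp [G]
  have hGK : G K = K.castSucc := hG K.castSucc
  have hG0 : G 0 = 0 := hG 0
  -- The rectangles: those of `γ` up to segment `K`, then the following ones along the tops.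
  let ρ : ℕ → Fin 4 := fun r => if r ≤ K then γ.rect (G r) else
    Z.π.symm (Z.π (γ.rect (G K)) + Fin.ofNat 4 (r - K))
  let x : ℕ → ℝ := fun r => if r = 0 then γ.x 0 else 0
  -- `W r` is the horizontal distance that a line from the start covers before rectangle `r`.
  let W : ℕ → ℝ := fun k => ∑ l ∈ range k, (Z.lam (ρ l) - x l)
  let U : ℝ := W K + γ.width (G K)
  -- In the development the tops from segment `K` on lie at the altitude `H` of the transversal.
  let H : ℝ := γ.y 0 + γ.slope * U
  let b : ℕ → ℝ := fun r => if r ≤ K then γ.y 0 + γ.slope * W r - γ.y (G r) else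
    H - Z.height (ρ r)
  -- The last index: the rectangle whose top ends at the right end of the transversal.
  let N : ℕ := K + (3 - (Z.π (γ.rect (G K))).val)
  have hWs : ∀ k, W (k + 1) = W k + (Z.lam (ρ k) - x k) := fun k => sum_range_succ _ _
  have hρ : ∀ k ≤ (K : ℕ), ρ k = γ.rect (G k) := fun k hk => if_pos hk
  have hρ0 : ρ 0 = γ.rect 0 := by rw [hρ 0 (Nat.zero_le _), hG0]
  have hb : ∀ k ≤ (K : ℕ), b k = γ.y 0 + γ.slope * W k - γ.y (G k) := fun k hk => if_pos hk
  have hx : ∀ k, x (k + 1) = 0 := fun k => if_neg k.succ_ne_zero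
  have hlast : ∀ k ≤ (K : ℕ), G k ≠ Fin.last γ.n := by
    intro k hk h
    have := congrArg Fin.val h
    have h2 := K.2
    simp only [G, Fin.val_ofNat, Fin.val_last] at this
    rw [Nat.mod_eq_of_lt (by omega)] at this
    omega
  have hnc : ∀ k ≤ (K : ℕ), γ.x (G k) + γ.width (G k) = Z.lam (γ.rect (G k)) →
      γ.y (G k) + γ.slope * γ.width (G k) ≠ Z.a (γ.rect (G k)).succ := by
    intro k hk h1 h2
    refine γ.not_isCone_right_end _ (hlast k hk) ?_
    rw [h1, h2]
    exact Z.isCone_right _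
  have hglue : ∀ k < (K : ℕ), Z.Glue (γ.rect (G k), γ.x (G k) + γ.width (G k),
      γ.y (G k) + γ.slope * γ.width (G k))
      (γ.rect (G (k + 1)), γ.x (G (k + 1)), γ.y (G (k + 1))) := by
    intro k hk
    have hkn : k < γ.n := hk.trans K.2
    have h1 : G k = (⟨k, hkn⟩ : Fin γ.n).castSucc := hG (⟨k, hkn⟩ : Fin γ.n).castSucc
    have h2 : G (k + 1) = (⟨k, hkn⟩ : Fin γ.n).succ := hG (⟨k, hkn⟩ : Fin γ.n).succ
    rw [h1, h2]
    exact γ.glue ⟨k, hkn⟩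
  have hnt : ∀ k < (K : ℕ), γ.y (G k) + γ.slope * γ.width (G k) ≠ Z.height (γ.rect (G k)) := by
    intro k hk
    have hkn : k < γ.n := hk.trans K.2
    have h1 : G k = (⟨k, hkn⟩ : Fin γ.n).castSucc := hG (⟨k, hkn⟩ : Fin γ.n).castSucc
    rw [h1]
    exact hfirst ⟨k, hkn⟩ hk
  have hxG : ∀ k ≤ (K : ℕ), γ.x (G k) = x k := by
    rintro (_ | k) hk
    · rw [hG0]; exact (if_pos rfl).symm
    · rw [hx]
      rcases (hglue k (by omega)).eq_or with h | h | h
      · exact h.2.2.1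
      · exact h.2.2.1
      · exact absurd h.1 (hnt k (by omega))
  have hWw : ∀ k < (K : ℕ), W (k + 1) = W k + γ.width (G k) := by
    intro k hk
    rw [hWs, hρ k hk.le, ← hxG k hk.le]
    rcases (hglue k hk).eq_or with h | h | h
    · linarith [h.2.1]
    · linarith [h.2.1]
    · exact absurd h.1 (hnt k hk)
  have hU : U = ∑ l ∈ Iic K.castSucc, γ.width l := by
    have : ∀ k ≤ (K : ℕ), W k = ∑ l ∈ range k, γ.width (G l) := by
      intro k
      induction k with
      | zero => exact fun _ => rfl
      | succ k ih =>
        intro hk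
        rw [hWw k hk, ih (by omega), sum_range_succ]
    rw [show U = ∑ l ∈ range (K + 1), γ.width (G l) by rw [sum_range_succ, ← this K le_rfl]]
    refine sum_nbij' G (fun l => l.val) ?_ ?_ ?_ (fun l _ => hG l) (fun _ _ => rfl)
    · intro l hl
      have h1 := mem_range.1 hl
      have h2 := K.2
      simp only [mem_Iic, Fin.le_def, G, Fin.val_ofNat, Fin.val_castSucc]
      rw [Nat.mod_eq_of_lt (by omega)]
      omega
    · intro l hl
      have h1 := mem_Iic.1 hl
      simp only [Fin.le_def, Fin.val_castSucc] at h1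
      exact mem_range.2 (by omega)
    · intro l hl
      have h1 := mem_range.1 hl
      have h2 := K.2
      simp only [G, Fin.val_ofNat]
      exact Nat.mod_eq_of_lt (by omega)
  rw [← hGK] at hK ⊢
  rw [← hGK] at hU
  rw [← hU]
  have hπ : ∀ r, (K : ℕ) ≤ r → r ≤ N → (Z.π (ρ r)).val = (Z.π (γ.rect (G K))).val + (r - K) := by
    intro r hr hrN
    rcases hr.eq_or_lt with h | h
    · rw [← h, hρ K le_rfl, Nat.sub_self, add_zero]
    · have h4 := (Z.π (γ.rect (G K))).2
      simp only [N] at hrN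
      simp only [ρ, if_neg (not_le.2 h), Equiv.apply_symm_apply, Fin.val_add, Fin.val_ofNat]
      omega
  have hzip : ∀ r, (K : ℕ) ≤ r → r < N → Z.π (ρ r) ≠ 3 ∧ Z.π (ρ (r + 1)) = Z.π (ρ r) + 1 := by
    intro r hr hrN
    have h1 := hπ r hr hrN.le
    have h2 := hπ (r + 1) (by omega) hrN
    have h4 := (Z.π (ρ (r + 1))).2
    refine ⟨fun h => ?_, Fin.ext ?_⟩
    · rw [h] at h1
      change 3 = _ at h1
      omega
    · rw [Fin.val_add]
      change _ = (_ + 1) % 4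
      omega
  have hbH : ∀ r, (K : ℕ) ≤ r → b r + Z.height (ρ r) = H := by
    intro r hr
    rcases hr.eq_or_lt with h | h
    · rw [← h, hb K le_rfl, hρ K le_rfl, ← hK]
      simp only [H, U]
      ring
    · simp only [b, if_neg (not_le.2 h)]
      ring
  have hWtop : ∀ r, (K : ℕ) ≤ r → r ≤ N → W (r + 1) - U = Z.topStart (ρ r) + Z.lam (ρ r) -
      (Z.topStart (γ.rect (G K)) + (γ.x (G K) + γ.width (G K))) := by
    intro r hr
    induction r, hr using Nat.le_induction with
    | base =>
      intro _
      rw [hWs, hρ K le_rfl, ← hxG K le_rfl]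
      simp only [U]
      ring
    | succ r hr ih =>
      intro hrN
      obtain ⟨h1, h2⟩ := hzip r hr hrN
      rw [hWs, hx, Z.topStart_succ h1 h2]
      linarith [ih (by omega)]
  obtain ⟨m1, m2, -, -⟩ := γ.mem_bounds (G K)
  -- Beyond the top, the line of slope `γ.slope` is strictly above all cone points.
  have habove : ∀ r, (K : ℕ) ≤ r → r ≤ N →
      b r + Z.a (ρ r).succ < γ.y 0 + γ.slope * W (r + 1) := by
    intro r hr hrN
    have h1 := hWtop r hr hrN
    have h2 := hbH r hr
    have h3 := Z.a_succ_le_height (ρ r)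
    have h4 : U < W (r + 1) → b r + Z.a (ρ r).succ < γ.y 0 + γ.slope * W (r + 1) := by
      intro h
      have := mul_lt_mul_of_pos_left h γ.slope_pos
      simp only [H] at h2
      linarith
    rcases hr.eq_or_lt with h | h
    · subst h
      rw [hρ K le_rfl] at h1 h2 h3 h4 ⊢
      rcases m2.eq_or_lt with h5 | h5
      · have h6 := lt_of_le_of_ne h3 fun h => hnc K le_rfl h5 (hK.trans h.symm)
        have h7 : W (K + 1) = U := by linarith
        rw [h7]
        simp only [H] at h2
        linarith
      · exact h4 (by linarith)
    · refine h4 ?_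
      have h5 : Z.π (γ.rect (G K)) < Z.π (ρ r) := by
        rw [Fin.lt_def, hπ r hr hrN]
        omega
      have h6 := Z.topStart_add_lam_le h5
      have h7 := Z.lam_pos (ρ r)
      linarith
  have hKN : (K : ℕ) ≤ N := Nat.le_add_right _ _
  have hN3 : Z.π (ρ N) = 3 := by
    have h1 := hπ N hKN le_rfl
    have h4 := (Z.π (γ.rect (G K))).2
    refine Fin.ext (h1.trans ?_)
    change _ = 3
    simp only [N]
    omega
  have hwidth0 := γ.width_pos 0
  obtain ⟨q1, q2, q3, -⟩ := γ.mem_bounds 0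
  have hUpos : 0 < U := by
    rw [hU]
    exact sum_pos (fun l _ => γ.width_pos l) ⟨_, mem_Iic.2 le_rfl⟩
  obtain ⟨γ', hs, hh⟩ := Z.exists_saddleConnection_slope_lt N ρ x b W (s := γ.slope)
    (y₀ := γ.y 0) q1 (by
      rw [hρ0]
      change γ.x 0 < _
      linarith) hx (fun _ => rfl)
    (by rw [hb 0 (Nat.zero_le _), hG0]; simp [W]) q3
    (by rw [hρ0]; exact γ.start_cone)
    (fun k hk => by
      rcases lt_or_ge k (K : ℕ) with hkK | hkK
      · have h1 := hWw k hkK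
        have h2 := hnc k hkK.le
        rw [hb k hkK.le, hb (k + 1) hkK, hρ k hkK.le, hρ (k + 1) hkK, h1]
        rcases (hglue k hkK).eq_or with ⟨e1, e2, e3, e4, e5⟩ | ⟨e1, e2, e3, e4, e5⟩ | h
        · have h3 := lt_of_le_of_ne e5 (h2 e2)
          exact Or.inl ⟨e1, by rw [e4]; ring, by linarith⟩
        · have h3 := lt_of_le_of_ne e5 (h2 e2).symm
          exact Or.inr ⟨e1, by rw [e4]; ring, by linarith⟩
        · exact absurd h.1 (hnt k hkK)
      · obtain ⟨h1, h2⟩ := hzip k hkK hk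
        have h3 := sigma_succ_of_eq h1 h2
        have h4 := Z.height_sub_a_succ h3
        have h5 := hbH k hkK
        have h6 := hbH (k + 1) (by omega)
        exact Or.inr ⟨h3, by linarith, habove k hkK hk.le⟩)
    (fun k hk => by
      rcases lt_or_ge k (K : ℕ) with hkK | hkK
      · left
        have h1 := (γ.mem_bounds (G k)).2.2.2
        rw [hb k hkK.le, hρ k hkK.le, hWw k hkK]
        linarith
      · right
        intro l hl _
        have h1 := hbH l (hkK.trans hl)
        have h2 := Z.a_succ_le_height (ρ l)
        linarith [hbH k hkK])
    (habove N hKN le_rfl)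
    (by
      rw [Z.a_succ_eq_height hN3, hbH N hKN]
      exact lt_add_of_pos_right _ (mul_pos γ.slope_pos hUpos))
  refine ⟨γ', hs, hh.trans_eq ?_⟩
  have h1 := hWtop N hKN le_rfl
  rw [Z.topStart_add_lam_of_last hN3] at h1
  linarith

end SaddleConnection

end ZipperedRectangles

theorem mainTheorem3 (Z : ZipperedRectangles)
    (hZ : 1 < (∑ i, Z.lam i) + Finset.univ.inf' Finset.univ_nonempty Z.lam)
    (γ : Z.SaddleConnection) (hγ : γ.HasSmallestSlope) :
    ¬ γ.PassesThroughTop := by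
  rintro ⟨k, t, ⟨ht0, ht⟩, htop, -, hlast⟩
  -- A line of positive slope reaches the top of a rectangle only where it leaves the rectangle.
  obtain rfl : t = γ.width k := by
    by_contra hne
    have h1 := mul_lt_mul_of_pos_left (lt_of_le_of_ne ht hne) γ.slope_pos
    linarith [(γ.mem_bounds k).2.2.2]
  have hk : k ≠ Fin.last γ.n := fun h => hlast ⟨h, rfl⟩
  let S : Finset (Fin γ.n) := Finset.univ.filter fun l =>
    γ.y l.castSucc + γ.slope * γ.width l.castSucc = Z.height (γ.rect l.castSucc)
  have hS : S.Nonempty := by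
    refine ⟨k.castPred hk, ?_⟩
    simpa [S] using htop
  let K := S.min' hS
  have hK : γ.y K.castSucc + γ.slope * γ.width K.castSucc = Z.height (γ.rect K.castSucc) :=
    (Finset.mem_filter.1 (S.min'_mem hS)).2
  have hfirst : ∀ l < K, γ.y l.castSucc + γ.slope * γ.width l.castSucc ≠
      Z.height (γ.rect l.castSucc) := fun l hl h =>
    hl.not_ge (S.min'_le l (Finset.mem_filter.2 ⟨Finset.mem_univ _, h⟩))
  obtain ⟨γ', hs, hh⟩ := γ.exists_slope_lt_of_first_top K hK hfirst
  refine (hγ.2 γ' (hh.trans ?_)).not_gt hs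
  have hnc := γ.not_isCone_right_end K.castSucc (Fin.castSucc_lt_last K).ne
  -- The next segment starts on the transversal, to the right of its left end.
  have hnext : γ.y K.succ = 0 ∧ Z.topStart (γ.rect K.castSucc) +
      (γ.x K.castSucc + γ.width K.castSucc) = Z.bottomStart (γ.rect K.succ) + γ.x K.succ := by
    rcases (γ.glue K).eq_or with ⟨-, h2, -, -, h5⟩ | ⟨e1, -, h3, h4, -⟩ | h
    · have h6 := le_antisymm h5 (hK ▸ Z.a_succ_le_height _)
      rw [h2, h6] at hnc
      exact absurd (Z.isCone_right _) hnc
    · -- A segment of positive slope cannot start at the upper left corner of a rectangle.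
      have h5 := Z.height_sub_a_succ e1
      have h6 := (γ.mem_bounds K.succ).2.2.2
      have h7 := mul_pos γ.slope_pos (γ.width_pos K.succ)
      linarith
    · exact h.2
  obtain ⟨hy, hp⟩ := hnext
  have hpos : 0 < Z.bottomStart (γ.rect K.succ) + γ.x K.succ := by
    rw [← hp]
    have h1 := Z.topStart_nonneg (γ.rect K.castSucc)
    have h2 := (γ.mem_bounds K.castSucc).1
    have h3 := γ.width_pos K.castSucc
    linarith
  have hle := γ.length_sub_le_sum_width (fun i hi => hγ.mul_le hi) K.succ
    (by rw [hy]; exact mul_pos γ.slope_pos hpos)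
  have hsum : ∑ l ∈ Finset.Iic K.castSucc, γ.width l + ∑ l ∈ Finset.Ici K.succ, γ.width l =
      γ.horizontal := by
    rw [ZipperedRectangles.SaddleConnection.horizontal, ← Finset.sum_union]
    · congr 1
      ext l
      simp only [Finset.mem_union, Finset.mem_Iic, Finset.mem_Ici, Finset.mem_univ, iff_true,
        Fin.le_def, Fin.val_castSucc, Fin.val_succ]
      omega
    · refine Finset.disjoint_left.2 fun l h1 h2 => ?_
      simp only [Finset.mem_Iic, Finset.mem_Ici, Fin.le_def, Fin.val_castSucc,
        Fin.val_succ] at h1 h2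
      omega
  have h1 := hγ.1
  rw [hp]
  linarith
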